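/- Ordinal terms (below $\varepsilon_0$) are built from $0$ by $\alpha\mapsto\omega^\alpha$ and $+$, modulo associativity of $+$ and $\alpha+0=\alpha=0+\alpha$; they are compared through the ordinals they denote, and $\mathrm{CNF}$ is the set of terms $\omega^{\beta_1}+\dots+\omega^{\beta_m}$ with $\beta_1\ge\dots\ge\beta_m$ and all $\beta_i$ in $\mathrm{CNF}$. Given $s:\mathbb N\to\mathbb N$, write $\omega_x=s(x)$; the fundamental sequences of limit terms are $$(\gamma+\omega^{\beta+1})_x=\gamma+\omega^\beta\cdot\omega_x,\qquad(\gamma+\omega^{\lambda})_x=\gamma+\omega^{\lambda_x}\quad(\lambda\text{ a limit}).$$ For $h:\mathbb N\to\mathbb N$ the fast growing hierarchy over $h$ is defined by $$f_0(x)=h(x),\qquad f_{\alpha+1}(x)=f_\alpha^{\omega_x}(x),\qquad f_\lambda(x)=f_{\lambda_x}(x)\quad(\lambda\text{ a limit}),$$ where $f_\alpha^{n}$ is the $n$-th iterate. $F_\alpha$ denotes $f_\alpha$ for $h(x)=x+1$ and $\omega_x=x$. The class $\mathfrak F_\alpha$ (extended Grzegorczyk hierarchy) is the closure of the constant functions,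 addition, the projections and $F_\alpha$ under substitution and limited recursion: if $h_1,h_2,h_3$ belong to the class, then so does $f$ if $f(0,\vec x)=h_1(\vec x)$, $f(y+1,\vec x)=h_2(y,\vec x,f(y,\vec x))$ and $f(y,\vec x)\le h_3(y,\vec x)$. **Lemma.** Let $(f_\alpha)$ be taken with $\omega_x=x$, or with $\omega_x=x+1$. Let $\gamma,\alpha\in\mathrm{CNF}$ with $\gamma>0$, and let $h:\mathbb N\to\mathbb N$ be monotone (i.e. non-decreasing) and eventually bounded by a unary function in $\mathfrak F_\gamma$ (that is, $h(x)\le g(x)$ for some $g\in\mathfrak F_\gamma$ and all sufficiently large $x$). 1. If $\alpha<\omega$, then there is a unary $g\in\mathfrak F_{\gamma+\alpha}$ with $f_\alpha(x)\le g(x)$ for all $x\in\mathbb N$. 2. If $\gamma<\omega$ and $\alpha\ge\omega$, then there is a unary $g\in\mathfrak F_{\alpha}$ with $f_\alpha(x)\le g(x)$ for all $x\in\mathbb N$. -/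

import Mathlib

open Filter Ordinal

/-- The ordinal terms `α ::= 0 | ω^α | α + α`, taken modulo associativity of `+` and the identities
`α + 0 = α = 0 + α`.  Modulo these, a term is a finite sum `ω^β₁ + ⋯ + ω^βₘ` of powers of `ω`, where
the `βᵢ` are arbitrary terms; `snoc γ β` is the sum `γ + ω^β` whose last summand is `ω^β`. -/
inductive OTerm : Type
  | zero : OTerm
  | snoc (γ β : OTerm) : OTerm

namespace OTerm

/-- The ordinal (below `ε₀`) denoted by a term. -/
noncomputable def ord : OTerm → Ordinal.{0}
  | zero => 0
  | snoc γ β => ord γ + ω ^ ord β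

/-- The formal sum of two terms (concatenation of the lists of summands). -/
def add (α : OTerm) : OTerm → OTerm
  | zero => α
  | snoc γ β => snoc (add α γ) β

instance : Add OTerm := ⟨add⟩

/-- Cantor normal form: `ω^β₁ + ⋯ + ω^βₘ` with `β₁ ≥ ⋯ ≥ βₘ` and every `βᵢ` in Cantor normal form. -/
def IsCNF : OTerm → Prop
  | zero => True
  | snoc zero β => IsCNF β
  | snoc (snoc γ δ) β => IsCNF (snoc γ δ) ∧ IsCNF β ∧ β.ord ≤ δ.ord

/-- The term `γ + ω^β · n`. -/
def addMul (γ β : OTerm) : ℕ → OTerm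
  | 0 => γ
  | n + 1 => snoc (addMul γ β n) β

/-- `fund n lam` is the element `lam_x` of the fundamental sequence of the limit term `lam`, where
`n` is the value `ω_x` chosen for `ω`:
`(γ + ω^(β+1))_x = γ + ω^β · ω_x` and `(γ + ω^μ)_x = γ + ω^(μ_x)` for `μ` a limit.
The values at `0` and at successors are never used. -/
def fund (n : ℕ) : OTerm → OTerm
  | zero => zero
  | snoc γ zero => γ
  | snoc γ (snoc β zero) => addMul γ β n
  | snoc γ (snoc β (snoc δ ε)) => snoc γ (fund n (snoc β (snoc δ ε)))

theorem ord_addMul (γ β : OTerm) (n : ℕ) : (addMul γ β n).ord = γ.ord + ω ^ β.ord * n := by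
  induction n with
  | zero => simp [addMul]
  | succ n ih => simp [addMul, ord, ih, mul_add, add_assoc]

theorem ord_lt_snoc (γ β : OTerm) : γ.ord < (snoc γ β).ord := by
  simpa [ord] using opow_pos β.ord omega0_pos

theorem ord_fund_lt (n : ℕ) : ∀ β γ : OTerm, (fund n (snoc γ β)).ord < (snoc γ β).ord
  | zero, γ => ord_lt_snoc γ zero
  | snoc β zero, γ => by
    simp only [fund, ord_addMul, ord, opow_zero]
    rw [opow_add, opow_one]
    gcongr
    · exact opow_pos _ omega0_pos
    · exact natCast_lt_omega0 n
  | snoc β (snoc δ ε), γ => by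
    have := ord_fund_lt n (snoc δ ε) β
    simp only [fund]
    rw [ord, ord]
    gcongr
    exact (opow_lt_opow_iff_right one_lt_omega0).2 this

/-- The fast growing hierarchy `(f_α)` over the control function `h`, for the fundamental sequences
with `ω_x = s x`:
`f_0(x) = h(x)`, `f_{α+1}(x) = f_α^{ω_x}(x)`, and `f_lam(x) = f_{lam_x}(x)` for `lam` a limit. -/
noncomputable def fast (h s : ℕ → ℕ) : OTerm → ℕ → ℕ
  | zero => h
  | snoc γ zero => fun x => (fast h s γ)^[s x] x
  | snoc γ (snoc β δ) => fun x => fast h s (fund (s x) (snoc γ (snoc β δ))) x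
termination_by α => ord α
decreasing_by
  · exact ord_lt_snoc γ zero
  · exact ord_fund_lt (s x) (snoc β δ) γ

/-- The standard fast growing functions `F_α`: control function `x + 1` and `ω_x = x`. -/
noncomputable def stdFast (α : OTerm) : ℕ → ℕ := fast (fun x => x + 1) (fun x => x) α

/-- The level `𝔉_α` of the extended Grzegorczyk hierarchy, functions of all arities: the closure of
the constants, addition, the projections and `F_α` under substitution and limited recursion. -/
inductive Grz (α : OTerm) : {n : ℕ} → ((Fin n → ℕ) → ℕ) → Prop
  | const {n : ℕ} (c : ℕ) : Grz α (fun _ : Fin n → ℕ => c)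
  | addition : Grz α (fun v : Fin 2 → ℕ => v 0 + v 1)
  | proj {n : ℕ} (i : Fin n) : Grz α (fun v : Fin n → ℕ => v i)
  | fastFun : Grz α (fun v : Fin 1 → ℕ => stdFast α (v 0))
  | subst {m n : ℕ} {h₀ : (Fin m → ℕ) → ℕ} {k : Fin m → (Fin n → ℕ) → ℕ} :
      Grz α h₀ → (∀ i, Grz α (k i)) → Grz α (fun v => h₀ (fun i => k i v))
  | limitedRec {n : ℕ} {h₁ : (Fin n → ℕ) → ℕ} {h₂ : (Fin (n + 2) → ℕ) → ℕ}
      {h₃ f : (Fin (n + 1) → ℕ) → ℕ} :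
      Grz α h₁ → Grz α h₂ → Grz α h₃ →
      (∀ v : Fin n → ℕ, f (Fin.cons 0 v) = h₁ v) →
      (∀ (y : ℕ) (v : Fin n → ℕ),
        f (Fin.cons (y + 1) v) =
          h₂ (Fin.cons y (Fin.snoc v (f (Fin.cons y v)) : Fin (n + 1) → ℕ))) →
      (∀ w : Fin (n + 1) → ℕ, f w ≤ h₃ w) → Grz α f

/-- The unary functions in `𝔉_α`. -/
def unaryGrz (α : OTerm) : Set (ℕ → ℕ) := {g | Grz α (fun v : Fin 1 → ℕ => g (v 0))}

end OTerm

/-! For `γ ≠ zero`, iterates of `F_γ` dominate all of `𝔉_γ`, so `h x + 1 ≤ F_γ^k (x + 1)`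
(`exists_iterate_bound`). For finite `α`, bounds of this form propagate: iterating one at most `x +
1` times costs about `k (x + 1)` iterates of `F_{γ+n}`, which a single `F_{γ+n+1}` at `(k + 1)(x +
1)` absorbs (`fast_addNat_bound`). For infinite `α` the index must not grow, so the bound is a
shift: `f_α x + c ≤ F_α (x + c)` (`fast_shift_le`). Successors and limits preserve it, limits by the
descent relation `Desc`. It starts where a fundamental sequence drops to a finite term `j`: there
`f_j` is below `F_{q+j}`, and the shift `c` pays for the extra `q`. -/

namespace OTerm

/-! ### Terms and fundamental sequences -/

/-- Induction along fundamental sequences. -/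
theorem fund_induction {P : OTerm → Prop} (zero : P zero) (succ : ∀ γ, P γ → P (snoc γ .zero))
    (lim : ∀ γ β, β ≠ OTerm.zero → (∀ n, P (fund n (snoc γ β))) → P (snoc γ β)) (α : OTerm) :
    P α := by
  induction hα : α.ord using WellFoundedLT.induction generalizing α with
  | ind o ih =>
    subst hα
    match α with
    | .zero => exact zero
    | snoc γ .zero => exact succ γ (ih _ (ord_lt_snoc γ .zero) γ rfl)
    | snoc γ (snoc β δ) =>
      exact lim γ _ (by simp) fun n => ih _ (ord_fund_lt n (snoc β δ) γ) _ rfl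

theorem fund_snoc_zero (n : ℕ) (γ : OTerm) : fund n (snoc γ zero) = γ := by
  simp [fund]

theorem fund_snoc_succ (n : ℕ) (γ β : OTerm) :
    fund n (snoc γ (snoc β zero)) = addMul γ β n := by
  simp [fund]

theorem fund_snoc_lim (n : ℕ) (γ β δ : OTerm) (hδ : δ ≠ zero) :
    fund n (snoc γ (snoc β δ)) = snoc γ (fund n (snoc β δ)) := by
  cases δ with
  | zero => exact absurd rfl hδ
  | snoc δ ε => simp [fund]

theorem addMul_ne_zero {γ β : OTerm} {n : ℕ} (hn : n ≠ 0) : addMul γ β n ≠ zero := by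
  cases n with
  | zero => exact absurd rfl hn
  | succ n => simp [addMul]

theorem fund_lim_ne_zero {n : ℕ} (hn : n ≠ 0) (γ : OTerm) {β : OTerm} (hβ : β ≠ zero) :
    fund n (snoc γ β) ≠ zero := by
  match β with
  | zero => exact absurd rfl hβ
  | snoc δ zero => rw [fund_snoc_succ]; exact addMul_ne_zero hn
  | snoc δ (snoc ε ζ) => rw [fund_snoc_lim _ _ _ _ (by simp)]; simp

/-- `Desc x α β`: the term `α` is reached from `β` by repeatedly taking predecessors or the
`x`-th elements of fundamental sequences. -/
def Desc (x : ℕ) (α β : OTerm) : Prop := ∃ k, (fund x)^[k] β = α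

theorem Desc.refl (x : ℕ) (α : OTerm) : Desc x α α := ⟨0, rfl⟩

theorem Desc.trans {x : ℕ} {α β γ : OTerm} : Desc x α β → Desc x β γ → Desc x α γ := by
  rintro ⟨k, rfl⟩ ⟨l, rfl⟩
  exact ⟨k + l, Function.iterate_add_apply _ _ _ _⟩

theorem Desc.fund (x : ℕ) (α : OTerm) : Desc x (fund x α) α := ⟨1, rfl⟩

theorem desc_addMul_of_desc_snoc {x : ℕ} {β : OTerm} (h : ∀ γ, Desc x γ (snoc γ β)) (γ : OTerm)
    {m n : ℕ} (hmn : m ≤ n) : Desc x (addMul γ β m) (addMul γ β n) := by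
  induction n, hmn using Nat.le_induction with
  | base => exact .refl _ _
  | succ n _ ih => exact ih.trans (h _)

theorem desc_snoc (x : ℕ) (β γ : OTerm) : Desc x γ (snoc γ β) := by
  induction β using fund_induction generalizing γ with
  | zero => exact ⟨1, fund_snoc_zero x γ⟩
  | succ β ih =>
    have h := Desc.fund x (snoc γ (snoc β zero))
    rw [fund_snoc_succ] at h
    exact (desc_addMul_of_desc_snoc ih γ (Nat.zero_le x)).trans h
  | lim β δ hδ ih =>
    have h := Desc.fund x (snoc γ (snoc β δ))
    rw [fund_snoc_lim _ _ _ _ hδ] at h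
    exact (ih x γ).trans h

theorem desc_addMul (x : ℕ) (γ β : OTerm) {m n : ℕ} (hmn : m ≤ n) :
    Desc x (addMul γ β m) (addMul γ β n) :=
  desc_addMul_of_desc_snoc (desc_snoc x β) γ hmn

theorem Desc.snoc {x : ℕ} (hx : 1 ≤ x) (γ : OTerm) {α β : OTerm} (h : Desc x α β) :
    Desc x (snoc γ α) (snoc γ β) := by
  obtain ⟨k, rfl⟩ := h
  induction k with
  | zero => exact .refl _ _
  | succ k ih =>
    rw [Function.iterate_succ_apply']
    refine Desc.trans ?_ ih
    generalize (OTerm.fund x)^[k] β = δ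
    match δ with
    | .zero => simpa [OTerm.fund] using Desc.refl x (OTerm.snoc γ .zero)
    | .snoc δ .zero =>
      have h := Desc.fund x (OTerm.snoc γ (.snoc δ .zero))
      rw [fund_snoc_succ] at h
      rw [fund_snoc_zero]
      exact (desc_addMul x γ δ hx).trans h
    | .snoc δ (.snoc ε ζ) =>
      rw [← fund_snoc_lim _ _ _ _ (by simp)]
      exact .fund _ _

/-- Bachmann-type property: it makes `F_lam` monotone in its argument at limits and allows comparing
different choices of `ω_x`. -/
theorem desc_fund_fund {x m n : ℕ} (hx : 1 ≤ x) (hmn : m ≤ n) :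
    ∀ β γ : OTerm, Desc x (fund m (snoc γ β)) (fund n (snoc γ β))
  | zero, γ => by simpa only [fund_snoc_zero] using Desc.refl x γ
  | snoc β zero, γ => by simpa only [fund_snoc_succ] using desc_addMul x γ β hmn
  | snoc β (snoc δ ε), γ => by
    simpa only [fund_snoc_lim _ _ _ _ (show snoc δ ε ≠ zero by simp)] using
      (desc_fund_fund hx hmn (snoc δ ε) β).snoc hx γ

/-! ### The fast growing hierarchy -/

theorem fast_snoc_zero (h s : ℕ → ℕ) (γ : OTerm) (x : ℕ) :
    fast h s (snoc γ zero) x = (fast h s γ)^[s x] x := by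
  rw [fast]

theorem fast_lim (h s : ℕ → ℕ) (γ : OTerm) {β : OTerm} (hβ : β ≠ zero) (x : ℕ) :
    fast h s (snoc γ β) x = fast h s (fund (s x) (snoc γ β)) x := by
  cases β with
  | zero => exact absurd rfl hβ
  | snoc β δ => rw [fast]

theorem stdFast_zero (x : ℕ) : stdFast zero x = x + 1 := by
  simp [stdFast, fast]

theorem stdFast_succ (γ : OTerm) (x : ℕ) : stdFast (snoc γ zero) x = (stdFast γ)^[x] x :=
  fast_snoc_zero _ _ _ _

theorem stdFast_lim (γ : OTerm) {β : OTerm} (hβ : β ≠ zero) (x : ℕ) :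
    stdFast (snoc γ β) x = stdFast (fund x (snoc γ β)) x :=
  fast_lim _ _ _ hβ _

theorem le_stdFast (α : OTerm) : id ≤ stdFast α := by
  induction α using fund_induction with
  | zero => intro x; simp [stdFast_zero]
  | succ γ ih =>
    intro x
    rw [stdFast_succ]
    exact Function.id_le_iterate_of_id_le ih x x
  | lim γ β hβ ih =>
    intro x
    rw [stdFast_lim _ hβ]
    exact ih x x

theorem iterate_stdFast_le (α : OTerm) {m n : ℕ} (h : m ≤ n) (x : ℕ) :
    (stdFast α)^[m] x ≤ (stdFast α)^[n] x :=
  Function.monotone_iterate_of_id_le (le_stdFast α) h x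

theorem stdFast_le_of_desc {x : ℕ} (hx : 1 ≤ x) {α β : OTerm} (h : Desc x α β) :
    stdFast α x ≤ stdFast β x := by
  obtain ⟨k, rfl⟩ := h
  induction k with
  | zero => exact le_rfl
  | succ k ih =>
    rw [Function.iterate_succ_apply']
    refine le_trans ?_ ih
    generalize (fund x)^[k] β = δ
    match δ with
    | zero => simp [fund]
    | snoc γ zero =>
      rw [fund_snoc_zero, stdFast_succ]
      exact iterate_stdFast_le γ hx x
    | snoc γ (snoc δ ε) => rw [stdFast_lim _ (by simp)]

theorem stdFast_mono (α : OTerm) : Monotone (stdFast α) := by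
  induction α using fund_induction with
  | zero => intro x y h; simpa [stdFast_zero] using h
  | succ γ ih =>
    intro x y h
    rw [stdFast_succ, stdFast_succ]
    exact (ih.iterate x h).trans (iterate_stdFast_le γ h y)
  | lim γ β hβ ih =>
    refine monotone_nat_of_le_succ fun x => ?_
    rw [stdFast_lim _ hβ, stdFast_lim _ hβ]
    -- Raise the argument first with the index fixed, then the index by descent at `x + 1 ≥ 1`.
    exact (ih x x.le_succ).trans
      (stdFast_le_of_desc (by omega) (desc_fund_fund (by omega) x.le_succ β γ))

theorem lt_stdFast (α : OTerm) {x : ℕ} (hx : 1 ≤ x) : x < stdFast α x := by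
  induction α using fund_induction with
  | zero => simp [stdFast_zero]
  | succ γ ih =>
    rw [stdFast_succ]
    exact ih.trans_le (iterate_stdFast_le γ hx x)
  | lim γ β hβ ih =>
    rw [stdFast_lim _ hβ]
    exact ih x

theorem add_le_iterate_stdFast (α : OTerm) {x : ℕ} (hx : 1 ≤ x) (n : ℕ) :
    x + n ≤ (stdFast α)^[n] x := by
  induction n with
  | zero => simp
  | succ n ih =>
    rw [Function.iterate_succ_apply']
    have := lt_stdFast α (show 1 ≤ (stdFast α)^[n] x by omega)
    omega

theorem two_mul_le_stdFast {α : OTerm} (hα : α ≠ zero) (x : ℕ) : 2 * x ≤ stdFast α x := by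
  rcases Nat.eq_zero_or_pos x with rfl | hx
  · simp
  induction α using fund_induction with
  | zero => exact absurd rfl hα
  | succ γ _ =>
    rw [stdFast_succ, two_mul]
    exact add_le_iterate_stdFast γ hx x
  | lim γ β hβ ih =>
    rw [stdFast_lim _ hβ]
    exact ih x (fund_lim_ne_zero hx.ne' γ hβ)

theorem mul_le_iterate_stdFast {α : OTerm} (hα : α ≠ zero) (n x : ℕ) :
    n * x ≤ (stdFast α)^[n] x := by
  -- Each application at least doubles, and `n ≤ 2 ^ n`.
  have h : ∀ n, 2 ^ n * x ≤ (stdFast α)^[n] x := fun n => by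
    induction n with
    | zero => simp
    | succ n ih =>
      rw [Function.iterate_succ_apply']
      refine le_trans ?_ (two_mul_le_stdFast hα _)
      rw [pow_succ', mul_assoc]
      gcongr
  exact (Nat.mul_le_mul_right x Nat.lt_two_pow_self.le).trans (h n)

/-! ### Functions of the extended Grzegorczyk hierarchy are bounded by iterates -/

/-- The `+ 1` on both sides keeps arguments positive, where `F_α` is strictly above the identity,
and lets bounds compose. Limited recursion just inherits the bound of its majorant. -/
theorem Grz.exists_iterate_bound {α : OTerm} (hα : α ≠ zero) {n : ℕ} {f : (Fin n → ℕ) → ℕ}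
    (hf : Grz α f) :
    ∃ k, ∀ m, 1 ≤ m → ∀ v : Fin n → ℕ, (∀ i, v i + 1 ≤ m) → f v + 1 ≤ (stdFast α)^[k] m := by
  induction hf with
  | const c =>
    refine ⟨c, fun m hm v _ => ?_⟩
    have := add_le_iterate_stdFast α hm c
    lia
  | addition =>
    refine ⟨1, fun m _ v hv => ?_⟩
    have h := two_mul_le_stdFast hα m
    have h0 := hv 0
    have h1 := hv 1
    simp only [Function.iterate_one]
    omega
  | proj i => exact ⟨0, fun m _ v hv => hv i⟩
  | fastFun =>
    refine ⟨2, fun m hm v hv => ?_⟩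
    have h1 : stdFast α (v 0) ≤ stdFast α m := stdFast_mono α (by have := hv 0; omega)
    have h2 := lt_stdFast α hm
    have h3 := lt_stdFast α (hm.trans h2.le)
    simp only [Function.iterate_succ_apply, Function.iterate_zero_apply]
    omega
  | @subst p n h₀ k _ _ ih₀ ih =>
    obtain ⟨l₀, h₀⟩ := ih₀
    choose l hl using ih
    refine ⟨l₀ + Finset.univ.sup l, fun m hm v hv => ?_⟩
    rw [Function.iterate_add_apply]
    refine h₀ _ ?_ _ fun i => (hl i m hm v hv).trans
      (iterate_stdFast_le α (Finset.le_sup (Finset.mem_univ i)) m)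
    have := add_le_iterate_stdFast α hm (Finset.univ.sup l)
    omega
  | limitedRec _ _ _ _ _ hle _ _ ih₃ =>
    obtain ⟨k, hk⟩ := ih₃
    exact ⟨k, fun m hm v hv => (Nat.succ_le_succ (hle v)).trans (hk m hm v hv)⟩

theorem iterate_stdFast_mem_unaryGrz (α : OTerm) (k c : ℕ) :
    (fun x => (stdFast α)^[k] (x + c)) ∈ unaryGrz α := by
  induction k with
  | zero =>
    have h := Grz.subst (α := α) (n := 1) (k := ![fun v => v 0, fun _ => c]) .addition
      (fun i => by fin_cases i; exacts [.proj 0, .const c])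
    simpa [unaryGrz] using h
  | succ k ih =>
    have h := Grz.subst (α := α) (n := 1) .fastFun (fun _ : Fin 1 => ih)
    simpa only [unaryGrz, Set.mem_ofPred_eq, Function.iterate_succ_apply'] using h

theorem exists_iterate_bound {γ : OTerm} (hγ : γ ≠ zero) {h : ℕ → ℕ} (h_mono : Monotone h)
    (h_bdd : ∃ g ∈ unaryGrz γ, ∀ᶠ x in atTop, h x ≤ g x) :
    ∃ k, ∀ x, h x + 1 ≤ (stdFast γ)^[k] (x + 1) := by
  obtain ⟨g, hg, hle⟩ := h_bdd
  obtain ⟨N, hN⟩ := eventually_atTop.1 hle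
  obtain ⟨k, hk⟩ := Grz.exists_iterate_bound hγ hg
  -- Below `N`, monotonicity gives `h x ≤ h N`, which the `h N` extra iterates cover.
  refine ⟨k + h N, fun x => ?_⟩
  rcases le_total N x with hx | hx
  · exact (Nat.succ_le_succ (hN x hx)).trans ((hk (x + 1) (by omega) (fun _ => x)
      fun _ => le_rfl).trans (iterate_stdFast_le γ (by omega) _))
  · have h1 := add_le_iterate_stdFast γ (show 1 ≤ x + 1 by omega) (k + h N)
    have h2 := h_mono hx
    omega

/-! ### Finite terms -/

/-- The term `γ + n` for a natural number `n`. -/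
abbrev addNat (γ : OTerm) (n : ℕ) : OTerm := addMul γ zero n

theorem ord_eq_zero {α : OTerm} (h : α.ord = 0) : α = zero := by
  cases α with
  | zero => rfl
  | snoc γ β => exact absurd (h ▸ ord_lt_snoc γ β) (not_lt_bot)

theorem add_addNat (γ : OTerm) (n : ℕ) : γ + addNat zero n = addNat γ n := by
  induction n with
  | zero => rfl
  | succ n ih => exact congrArg (snoc · zero) ih

theorem exists_eq_addNat {α : OTerm} (h : α.ord < ω) : ∃ n, α = addNat zero n := by
  induction α with
  | zero => exact ⟨0, rfl⟩
  | snoc γ β ih _ =>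
    obtain ⟨n, rfl⟩ := ih ((ord_lt_snoc γ β).trans h)
    have hβ : β = zero := by
      refine ord_eq_zero (Order.lt_one_iff.1 ?_)
      have h' : ω ^ β.ord < ω ^ (1 : Ordinal) := by
        rw [opow_one]
        exact le_add_self.trans_lt h
      exact (opow_lt_opow_iff_right one_lt_omega0).1 h'
    exact ⟨n + 1, by rw [hβ]; rfl⟩

theorem addNat_ne_zero {γ : OTerm} (hγ : γ ≠ zero) (n : ℕ) : addNat γ n ≠ zero := by
  cases n with
  | zero => exact hγ
  | succ n => simp [addNat, addMul]

theorem fast_addNat_bound {h s : ℕ → ℕ} (hs : ∀ x, s x ≤ x + 1) {γ : OTerm} (hγ : γ ≠ zero)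
    (hb : ∃ k, ∀ x, h x + 1 ≤ (stdFast γ)^[k] (x + 1)) (n : ℕ) :
    ∃ k, ∀ x, fast h s (addNat zero n) x + 1 ≤ (stdFast (addNat γ n))^[k] (x + 1) := by
  induction n with
  | zero => simpa [addNat, addMul, fast] using hb
  | succ n ih =>
    obtain ⟨k, hk⟩ := ih
    have iter : ∀ i x, (fast h s (addNat zero n))^[i] x + 1 ≤
        (stdFast (addNat γ n))^[k * i] (x + 1) := fun i x => by
      induction i with
      | zero => simp
      | succ i ih =>
        rw [Function.iterate_succ_apply', Nat.mul_succ, Nat.add_comm (k * i),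
          Function.iterate_add_apply]
        exact (hk _).trans ((stdFast_mono _).iterate k ih)
    refine ⟨1 + (k + 1), fun x => ?_⟩
    have hM : x + 1 ≤ (k + 1) * (x + 1) := Nat.le_mul_of_pos_left _ (by omega)
    have hne : addNat γ (n + 1) ≠ zero := addNat_ne_zero hγ _
    calc fast h s (addNat zero (n + 1)) x + 1
        = (fast h s (addNat zero n))^[s x] x + 1 := by
          rw [← fast_snoc_zero]; rfl
      _ ≤ (stdFast (addNat γ n))^[k * s x] (x + 1) := iter _ _
      _ ≤ (stdFast (addNat γ n))^[(k + 1) * (x + 1)] (x + 1) :=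
          iterate_stdFast_le _ (Nat.mul_le_mul k.le_succ (hs x)) _
      _ ≤ (stdFast (addNat γ n))^[(k + 1) * (x + 1)] ((k + 1) * (x + 1)) :=
          (stdFast_mono _).iterate _ hM
      _ = stdFast (addNat γ (n + 1)) ((k + 1) * (x + 1)) := (stdFast_succ _ _).symm
      _ ≤ stdFast (addNat γ (n + 1)) ((stdFast (addNat γ (n + 1)))^[k + 1] (x + 1)) :=
          stdFast_mono _ (mul_le_iterate_stdFast hne _ _)
      _ = _ := by rw [Function.iterate_add_apply _ 1, Function.iterate_one]

/-! ### Infinite terms -/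

/-- The exponent of the leading summand (`0` for the term `0`). -/
def leadExp : OTerm → OTerm
  | zero => zero
  | snoc zero β => β
  | snoc (snoc γ δ) _ => leadExp (snoc γ δ)

theorem leadExp_snoc {γ : OTerm} (hγ : γ ≠ zero) (β : OTerm) :
    leadExp (snoc γ β) = leadExp γ := by
  cases γ with
  | zero => exact absurd rfl hγ
  | snoc γ δ => rfl

theorem leadExp_addMul {γ : OTerm} (hγ : γ ≠ zero) (β : OTerm) (n : ℕ) :
    leadExp (addMul γ β n) = leadExp γ ∧ addMul γ β n ≠ zero := by
  induction n with
  | zero => exact ⟨rfl, hγ⟩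
  | succ n ih => exact ⟨(leadExp_snoc ih.2 β).trans ih.1, by simp [addMul]⟩

theorem leadExp_zero_addMul (β : OTerm) {n : ℕ} (hn : n ≠ 0) :
    leadExp (addMul zero β n) = β := by
  induction n with
  | zero => exact absurd rfl hn
  | succ n ih =>
    rcases eq_or_ne n 0 with rfl | hn
    · rfl
    · exact (leadExp_snoc (addMul_ne_zero hn) β).trans (ih hn)

/-- The exponents are non-increasing, so a zero leading exponent makes all of them zero. -/
theorem IsCNF.eq_addNat {α : OTerm} (hα : α.IsCNF) (h : leadExp α = zero) :
    ∃ n, α = addNat zero n := by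
  induction α with
  | zero => exact ⟨0, rfl⟩
  | snoc γ β ih _ =>
    match γ with
    | zero => exact ⟨1, by rw [show β = zero from h]; rfl⟩
    | snoc γ δ =>
      obtain ⟨h1, -, h3⟩ := hα
      obtain ⟨n, hn⟩ := ih h1 h
      cases n with
      | zero => exact absurd hn (by simp [addNat, addMul])
      | succ n =>
        obtain ⟨-, rfl⟩ := OTerm.snoc.inj hn
        have hβ : β = zero := ord_eq_zero (by simpa [ord] using h3)
        exact ⟨n + 2, by rw [hn, hβ]; rfl⟩

theorem ord_addNat_lt (n : ℕ) : (addNat zero n).ord < ω := by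
  simp [ord_addMul, ord]

theorem IsCNF.leadExp_ne_zero {α : OTerm} (hα : α.IsCNF) (h : ω ≤ α.ord) :
    leadExp α ≠ zero := fun h0 => by
  obtain ⟨n, rfl⟩ := hα.eq_addNat h0
  exact absurd h (ord_addNat_lt n).not_ge

/-- The leading exponent vanishes only at `ω` itself or for `n = 0`; the last alternative is `ω^μ`
with `μ_0 = 0`. -/
theorem leadExp_fund {γ β : OTerm} (hβ : β ≠ zero) (h : leadExp (snoc γ β) ≠ zero) (n : ℕ) :
    leadExp (fund n (snoc γ β)) ≠ zero ∨ fund n (snoc γ β) = addNat zero n ∨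
      (n = 0 ∧ fund n (snoc γ β) = addNat zero 1) := by
  match β with
  | zero => exact absurd rfl hβ
  | snoc δ zero =>
    rw [fund_snoc_succ]
    rcases eq_or_ne γ zero with rfl | hγ
    · rcases eq_or_ne δ zero with rfl | hδ
      · exact .inr (.inl rfl)
      · rcases eq_or_ne n 0 with rfl | hn
        · exact .inr (.inl rfl)
        · exact .inl (by rwa [leadExp_zero_addMul δ hn])
    · rw [leadExp_snoc hγ] at h
      exact .inl (by rwa [(leadExp_addMul hγ δ n).1])
  | snoc δ (snoc ε ζ) =>
    rw [fund_snoc_lim _ _ _ _ (by simp)]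
    rcases eq_or_ne γ zero with rfl | hγ
    · by_cases h0 : fund n (snoc δ (snoc ε ζ)) = zero
      · have hn : n = 0 := by
          by_contra hn
          exact fund_lim_ne_zero hn _ (by simp) h0
        exact .inr (.inr ⟨hn, by rw [h0]; rfl⟩)
      · exact .inl h0
    · rw [leadExp_snoc hγ] at h
      exact .inl (by rwa [leadExp_snoc hγ])

/-- For `x ≥ 1` the descent can leave the infinite terms only through `ω`, whose `x`-th element is
`x`. -/
theorem desc_addNat_of_leadExp_ne_zero {x : ℕ} (hx : 1 ≤ x) {α : OTerm}
    (h : leadExp α ≠ zero) : Desc x (addNat zero x) α := by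
  induction α using fund_induction with
  | zero => exact absurd rfl h
  | succ γ ih =>
    rcases eq_or_ne γ zero with rfl | hγ
    · exact absurd rfl h
    · rw [leadExp_snoc hγ] at h
      exact (ih h).trans (desc_snoc x zero γ)
  | lim γ β hβ ih =>
    rcases leadExp_fund hβ h x with h1 | h1 | ⟨h1, -⟩
    · exact (ih x h1).trans (.fund x _)
    · exact h1 ▸ .fund x _
    · omega

theorem iterate_shift_le {a : ℕ → ℕ} {β : OTerm} {c : ℕ}
    (h : ∀ x, a x + c ≤ stdFast β (x + c)) (i x : ℕ) :
    a^[i] x + c ≤ (stdFast β)^[i] (x + c) := by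
  induction i with
  | zero => simp
  | succ i ih =>
    rw [Function.iterate_succ_apply', Function.iterate_succ_apply']
    exact (h _).trans (stdFast_mono β ih)

theorem fast_succ_shift_le {h s : ℕ → ℕ} {c : ℕ} (hs : ∀ x, s x ≤ x + c) {α β : OTerm}
    (hab : ∀ x, fast h s α x + c ≤ stdFast β (x + c)) (x : ℕ) :
    fast h s (snoc α zero) x + c ≤ stdFast (snoc β zero) (x + c) := by
  rw [fast_snoc_zero, stdFast_succ]
  exact (iterate_shift_le hab _ x).trans (iterate_stdFast_le β (hs x) _)

theorem fast_addNat_shift_le {h s : ℕ → ℕ} {c q : ℕ} (hs : ∀ x, s x ≤ x + c)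
    (hb : ∀ x, h x + c ≤ stdFast (addNat zero q) (x + c)) (n x : ℕ) :
    fast h s (addNat zero n) x + c ≤ stdFast (addNat zero (q + n)) (x + c) := by
  induction n generalizing x with
  | zero => simpa [addNat, addMul, fast] using hb x
  | succ n ih => exact fast_succ_shift_le hs ih x

theorem fast_shift_le {h s : ℕ → ℕ} {c q : ℕ} (hs : ∀ x, s x ≤ x + 1) (hc : q + 1 ≤ c)
    (hb : ∀ x, h x + c ≤ stdFast (addNat zero q) (x + c)) {α : OTerm} (hα : leadExp α ≠ zero)
    (x : ℕ) : fast h s α x + c ≤ stdFast α (x + c) := by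
  have hs' : ∀ x, s x ≤ x + c := fun x => (hs x).trans (by omega)
  induction α using fund_induction generalizing x with
  | zero => exact absurd rfl hα
  | succ γ ih =>
    rcases eq_or_ne γ zero with rfl | hγ
    · exact absurd rfl hα
    · rw [leadExp_snoc hγ] at hα
      exact fast_succ_shift_le hs' (ih hα) x
  | lim γ β hβ ih =>
    have hx : 1 ≤ x + c := by omega
    -- `α` descends at `x + c` to the finite term `x + c`, hence to `q + j`.
    have finite : ∀ j, q + j ≤ x + c → fund (s x) (snoc γ β) = addNat zero j →
        fast h s (snoc γ β) x + c ≤ stdFast (snoc γ β) (x + c) := fun j hj hf => by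
      rw [fast_lim _ _ _ hβ, hf]
      exact (fast_addNat_shift_le hs' hb j x).trans (stdFast_le_of_desc hx
        ((desc_addMul _ zero zero hj).trans (desc_addNat_of_leadExp_ne_zero hx hα)))
    rcases leadExp_fund hβ hα (s x) with h1 | h1 | ⟨-, h1⟩
    · rw [fast_lim _ _ _ hβ, stdFast_lim _ hβ]
      exact (ih _ h1 x).trans (stdFast_le_of_desc hx (desc_fund_fund hx (hs' x) β γ))
    · exact finite _ (by have := hs x; omega) h1
    · exact finite 1 (by omega) h1

theorem exists_shift_bound {h : ℕ → ℕ} {γ : OTerm} (hγ : γ ≠ zero)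
    (hb : ∃ k, ∀ x, h x + 1 ≤ (stdFast γ)^[k] (x + 1)) (d : ℕ) :
    ∃ c, d ≤ c ∧ ∀ x, h x + c ≤ stdFast (snoc γ zero) (x + c) := by
  obtain ⟨k, hk⟩ := hb
  -- With `c ≥ k + 1`, the `k + 1` iterates (the last one doubling, to fit the summand `c`) are
  -- among the `x + c` iterates making up `F_{γ+1} (x + c)`.
  refine ⟨k + d + 1, by omega, fun x => ?_⟩
  set c := k + d + 1
  have h1 : h x + 1 ≤ (stdFast γ)^[k] (x + c) :=
    (hk x).trans ((stdFast_mono γ).iterate k (by omega))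
  have h2 : x + c ≤ (stdFast γ)^[k] (x + c) :=
    Function.id_le_iterate_of_id_le (le_stdFast γ) k (x + c)
  have h3 := two_mul_le_stdFast hγ ((stdFast γ)^[k] (x + c))
  rw [← Function.iterate_succ_apply' (stdFast γ), Nat.succ_eq_add_one] at h3
  have h4 := iterate_stdFast_le γ (show k + 1 ≤ x + c by omega) (x + c)
  rw [stdFast_succ]
  omega

end OTerm

theorem mainTheorem10
    (s : ℕ → ℕ) (hs : (∀ x, s x = x) ∨ (∀ x, s x = x + 1))
    (h : ℕ → ℕ) (γ α : OTerm) (hγ : γ.IsCNF) (hα : α.IsCNF) (hγ_pos : 0 < γ.ord)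
    (h_mono : Monotone h)
    (h_bdd : ∃ g ∈ OTerm.unaryGrz γ, ∀ᶠ x in atTop, h x ≤ g x) :
    (α.ord < ω → ∃ g ∈ OTerm.unaryGrz (γ + α), ∀ x, OTerm.fast h s α x ≤ g x) ∧
    (γ.ord < ω → ω ≤ α.ord → ∃ g ∈ OTerm.unaryGrz α, ∀ x, OTerm.fast h s α x ≤ g x) := by
  have hs' : ∀ x, s x ≤ x + 1 := fun x => by rcases hs with hs | hs <;> simp [hs x]
  have hγ0 : γ ≠ OTerm.zero := by
    rintro rfl
    exact hγ_pos.ne rfl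
  have hb := OTerm.exists_iterate_bound hγ0 h_mono h_bdd
  constructor
  · intro hfin
    obtain ⟨n, rfl⟩ := OTerm.exists_eq_addNat hfin
    obtain ⟨k, hk⟩ := OTerm.fast_addNat_bound hs' hγ0 hb n
    rw [OTerm.add_addNat]
    exact ⟨_, OTerm.iterate_stdFast_mem_unaryGrz _ k 1, fun x => (Nat.le_succ _).trans (hk x)⟩
  · intro hfin hinf
    obtain ⟨p, rfl⟩ := OTerm.exists_eq_addNat hfin
    -- With `q = p + 1`, this `c` gives `q + s x ≤ x + c` even when `s x = x + 1`.
    obtain ⟨c, hc, hcb⟩ := OTerm.exists_shift_bound hγ0 hb (p + 1 + 1)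
    refine ⟨_, OTerm.iterate_stdFast_mem_unaryGrz α 1 c, fun x => ?_⟩
    exact (Nat.le_add_right _ c).trans
      (OTerm.fast_shift_le (q := p + 1) hs' hc hcb (hα.leadExp_ne_zero hinf) x)
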